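/- Let $\$:[0,+\infty)\times\{1,2,3,\dots\}\to[1,+\infty]$ be a cost function, i.e. $\$(\sigma,d)$ is non-increasing in $\sigma$ and non-decreasing in $d$. For $d\ge 1$ put $$h_1(x,d)=\$\big(\sqrt{1/x},\,d\big)\quad(x>0),\qquad h_{2,\lambda}(x,d)=\$\Big(\sqrt{\tfrac{\lambda x}{\lambda-x}},\,d\Big)\quad(0<x<\lambda).$$ Consider approximating an unknown real number $f\in\mathbb R$ from adaptive noisy observations $$y_i=f+e_i,\qquad e_i\sim\mathcal N\big(0,\sigma_i^2(y_1,\dots,y_{i-1})\big),\qquad i=1,2,\dots,n(\mathbf y),$$ with independent noise (that is, $e_i=\sigma_i(y_1,\dots,y_{i-1})\,\xi_i$ with i.i.d. standard Gaussian $\xi_i$). Here the precisions $\sigma_i(\cdot)\in[0,\infty)$ are measurable functions of the previously obtained values, and the process terminates when $(y_1,\dots,y_n)\in Y$, where $Y$ is a measurable set of finite real sequences such that every infinite sequence $(y_1,y_2,\dots)$ has exactly one initial segment in $Y$. Such a choice of precisions and of $Y$ is called information $N$; let $\pi_f$ be the distribution on $Y$ of the information $\mathbf y=(y_1,\dots,y_{n(\mathbf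 y)})$ about $f$. For a measurable algorithm $\Phi:Y\to\mathbb R$ let $$\mathrm{cost}(N)=\sup_{f\in\mathbb R}\int_Y\sum_{i=1}^{n(\mathbf y)}\$\big(\sigma_i(y_1,\dots,y_{i-1}),d\big)\,\pi_f(\mathrm d\mathbf y),\qquad \mathrm e(N,\Phi)=\sup_{f\in\mathbb R}\Big(\int_Y|f-\Phi(\mathbf y)|^2\,\pi_f(\mathrm d\mathbf y)\Big)^{1/2},$$ and define the auxiliary cost function $$\widehat{\$}(\sigma,d)=\inf\{\mathrm{cost}(N):\ N,\Phi\text{ such that }\mathrm e(N,\Phi)\le\sigma\},\qquad \sigma\ge 0 .$$ Then for every $d\ge 1$ the following hold. (i) If $h_1(\cdot,d)$ is concave on $(0,\infty)$ and $h_{2,\lambda}(\cdot,d)$ is convex on $(0,\lambda)$ for all sufficiently large $\lambda$, then $\widehat{\$}(\sigma,d)=\$(\sigma,d)$ for all $\sigma\ge 0$. (ii) Suppose that there are $\alpha\in\mathbb R$ and $x_0>0$ with $\alpha x_0=h_1(x_0,d)$ and $\alpha x\le h_1(x,d)$ for all $x>0$. Then, with $\sigma_0^2=1/x_0$, for all $\sigma>0$,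 $$\frac{\alpha}{\sigma^2}\le\widehat{\$}(\sigma,d)\le\Big\lceil\frac{\sigma_0^2}{\sigma^2}\Big\rceil\frac{\alpha}{\sigma_0^2}.$$ (iii) For all $\sigma_0>0$ and $\sigma>0$, $$\widehat{\$}(\sigma,d)\le\Big\lceil\frac{\sigma_0^2}{\sigma^2}\Big\rceil\,\$(\sigma_0,d).$$ -/

import Mathlib

open Set Filter MeasureTheory ProbabilityTheory
open scoped NNReal ENNReal

noncomputable section

/-- A cost function `$ : [0,∞) × {1,2,…} → [1,∞]`, non-decreasing in `σ⁻¹` (that is, non-increasing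
in `σ`) and non-decreasing in `d`. -/
structure CostFunction where
  toFun : ℝ≥0 → ℕ+ → ℝ≥0∞
  one_le : ∀ σ d, 1 ≤ toFun σ d
  antitone_prec : ∀ d, Antitone fun σ => toFun σ d
  monotone_dim : ∀ σ, Monotone fun d => toFun σ d

instance : CoeFun CostFunction (fun _ => ℝ≥0 → ℕ+ → ℝ≥0∞) := ⟨CostFunction.toFun⟩

/-- `h₁(x,d) = $(√(1/x), d)`, of interest for `x ∈ (0,∞)`. -/
def CostFunction.h₁ (c : CostFunction) (d : ℕ+) (x : ℝ≥0) : ℝ≥0∞ :=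
  c (NNReal.sqrt (1 / x)) d

/-- `h_{2,λ}(x,d) = $(√(λx/(λ-x)), d)`, of interest for `x ∈ (0,λ)`. -/
def CostFunction.h₂ (c : CostFunction) (lam : ℝ≥0) (d : ℕ+) (x : ℝ≥0) : ℝ≥0∞ :=
  c (NNReal.sqrt (lam * x / (lam - x))) d

/-- Finite sequences of real numbers, of various lengths (possible values of information). -/
abbrev FinSeq : Type := Σ n : ℕ, Fin n → ℝ

/-- Adaptive information about a real parameter: the precision of the next observation depends on
the previously obtained values, and the process stops as soon as the sequence of obtained values
belongs to `range`. Every infinite sequence has exactly one initial segment in `range`. -/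
structure AdaptiveInfo where
  /-- `prec n (y₁,…,yₙ)` is the precision of the observation number `n + 1`. -/
  prec : (n : ℕ) → (Fin n → ℝ) → ℝ≥0
  measurable_prec : ∀ n, Measurable (prec n)
  /-- The set `Y` of all values of information. -/
  range : Set FinSeq
  measurableSet_range : MeasurableSet range
  existsUnique_length : ∀ y : ℕ → ℝ, ∃! n : ℕ, (⟨n, fun i => y i⟩ : FinSeq) ∈ range

namespace AdaptiveInfo

/-- The successive observations `yₙ = f + eₙ` with noise `eₙ = σₙ(y₁,…,yₙ₋₁) ξₙ`, where the `ξₙ`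
will be independent standard Gaussian variables. -/
def obs (N : AdaptiveInfo) (f : ℝ) (ξ : ℕ → ℝ) (n : ℕ) : ℝ :=
  f + (N.prec n fun i : Fin n => obs N f ξ i) * ξ n
termination_by n
decreasing_by exact i.2

/-- The number of observations made along the sequence `y`. -/
def length (N : AdaptiveInfo) (y : ℕ → ℝ) : ℕ := (N.existsUnique_length y).choose

/-- The value of information: the initial segment of `y` at which the process stops. -/
def stopped (N : AdaptiveInfo) (y : ℕ → ℝ) : FinSeq := ⟨N.length y, fun i => y i⟩

/-- The distribution `π_f` of the information about `f`. -/
def law (N : AdaptiveInfo) (f : ℝ) : Measure FinSeq :=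
  (Measure.infinitePi fun _ : ℕ => gaussianReal 0 1).map fun ξ => N.stopped (N.obs f ξ)

/-- The cost of a value `y = (y₁,…,yₙ)` of information, `∑ᵢ $(σᵢ(y₁,…,yᵢ₋₁), d)`. -/
def pathCost (N : AdaptiveInfo) (c : CostFunction) (d : ℕ+) (y : FinSeq) : ℝ≥0∞ :=
  ∑ i : Fin y.1, c (N.prec i fun j : Fin i => y.2 (j.castLE i.2.le)) d

/-- The worst case expected cost of information, over all `f ∈ ℝ`. -/
def cost (N : AdaptiveInfo) (c : CostFunction) (d : ℕ+) : ℝ≥0∞ :=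
  ⨆ f : ℝ, ∫⁻ y, N.pathCost c d y ∂(N.law f)

/-- The worst case root mean square error of the algorithm `Φ`, over all `f ∈ ℝ`. -/
def error (N : AdaptiveInfo) (Φ : FinSeq → ℝ) : ℝ≥0∞ :=
  ⨆ f : ℝ, (∫⁻ y, ENNReal.ofReal ((f - Φ y) ^ 2) ∂(N.law f)) ^ (1 / 2 : ℝ)

/-- The map defining `law` is measurable, so that `law` is an image measure in the usual sense. -/
theorem measurable_stopped_obs (N : AdaptiveInfo) (f : ℝ) :
    Measurable fun ξ : ℕ → ℝ => N.stopped (N.obs f ξ) := by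
  have hobs : ∀ n, Measurable fun ξ : ℕ → ℝ => N.obs f ξ n := by
    intro n
    induction n using Nat.strong_induction_on with
    | _ n ih =>
      have h : (fun ξ : ℕ → ℝ => N.obs f ξ n) =
          fun ξ => f + (N.prec n fun i : Fin n => N.obs f ξ i) * ξ n := by
        funext ξ
        rw [obs]
      rw [h]
      have h2 : Measurable fun ξ : ℕ → ℝ => N.prec n fun i : Fin n => N.obs f ξ i :=
        (N.measurable_prec n).comp (measurable_pi_lambda _ fun i => ih i i.2)
      exact (h2.coe_nnreal_real.mul (measurable_pi_apply n)).const_add f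
  have hst : Measurable N.stopped := by
    intro S hS
    have : N.stopped ⁻¹' S =
        ⋃ n : ℕ, {y : ℕ → ℝ | (⟨n, fun i => y i⟩ : FinSeq) ∈ N.range ∩ S} := by
      ext y
      simp only [mem_preimage, mem_iUnion, mem_ofPred_eq, mem_inter_iff]
      constructor
      · intro h
        exact ⟨N.length y, (N.existsUnique_length y).choose_spec.1, h⟩
      · rintro ⟨n, h1, h2⟩
        have : n = N.length y := (N.existsUnique_length y).choose_spec.2 n h1
        subst this
        exact h2
    rw [this]
    refine MeasurableSet.iUnion fun n => ?_
    have h1 : Measurable fun y : ℕ → ℝ => (fun i : Fin n => y i) :=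
      measurable_pi_lambda _ fun i => measurable_pi_apply _
    have h2 : Measurable (Sigma.mk (β := fun n : ℕ => Fin n → ℝ) n) := fun s hs => by
      rw [MeasurableSpace.measurableSet_iInf] at hs
      exact hs n
    exact (h2.comp h1) (N.measurableSet_range.inter hS)
  exact hst.comp (measurable_pi_lambda _ hobs)

end AdaptiveInfo

/-- The auxiliary cost function `$̂`: `auxCost c σ d` is the minimal cost of information sufficient
for approximating a real parameter with error at most `σ`, when single observations
are charged by `c · d`. -/
def auxCost (c : CostFunction) (σ : ℝ≥0) (d : ℕ+) : ℝ≥0∞ :=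
  sInf {C | ∃ (N : AdaptiveInfo) (Φ : FinSeq → ℝ), Measurable Φ ∧
    N.error Φ ≤ (σ : ℝ≥0∞) ∧ C = N.cost c d}

end

/-
Under a centered Gaussian prior of variance `λ`, the posterior law of the parameter given the
information is Gaussian with variance `V = (1/λ + ∑ᵢ σᵢ⁻²)⁻¹`, even though the precisions are
adaptive; so `E V ≤ σ²` for every algorithm of error at most `σ`. The cost of a path is bounded
below by a convex function of `V`: by `h_{2,λ}(V)` in (i), since a concave `h₁` is subadditive, and
by `α ∑ᵢ σᵢ⁻² = α (1/V - 1/λ)` in (ii). Replacing this function by its tangent line at `σ²` turns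
the bound on `E V` into a lower bound for the cost, and `λ → ∞` gives the claim. The upper bounds
come from averaging `⌈σ₀²/σ²⌉` observations of precision `σ₀`.
-/

section Measurability

theorem measurable_sigmaMk {ι : Type*} {β : ι → Type*} [∀ i, MeasurableSpace (β i)] (i : ι) :
    Measurable (Sigma.mk i : β i → Sigma β) :=
  fun _ hs => MeasurableSpace.measurableSet_iInf.1 hs i

theorem measurable_of_comp_sigmaMk {ι γ : Type*} {β : ι → Type*} [∀ i, MeasurableSpace (β i)]
    [MeasurableSpace γ] {g : Sigma β → γ} (h : ∀ i, Measurable (g ∘ Sigma.mk i)) :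
    Measurable g :=
  fun _ hs => MeasurableSpace.measurableSet_iInf.2 fun i => h i hs

theorem measurable_finSnoc {α : Type*} [MeasurableSpace α] {n : ℕ} :
    Measurable fun p : (Fin n → α) × α => (Fin.snoc p.1 p.2 : Fin (n + 1) → α) := by
  refine measurable_pi_lambda _ fun i => ?_
  induction i using Fin.lastCases with
  | last => simpa only [Fin.snoc_last] using measurable_snd
  | cast i => simpa only [Fin.snoc_castSucc] using by fun_prop

theorem map_update_infinitePi {ι : Type*} [DecidableEq ι] {X : ι → Type*}
    [∀ i, MeasurableSpace (X i)] (μ : ∀ i, Measure (X i)) [∀ i, IsProbabilityMeasure (μ i)]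
    (i : ι) :
    ((Measure.infinitePi μ).prod (μ i)).map (fun p => Function.update p.1 i p.2) =
      Measure.infinitePi μ := by
  refine Measure.eq_infinitePi μ fun s t ht => ?_
  have hpre : (fun p : (∀ j, X j) × X i => Function.update p.1 i p.2) ⁻¹' (Set.pi s t) =
      Set.pi (s.erase i) t ×ˢ {x | i ∈ s → x ∈ t i} := by
    ext p
    rw [mem_preimage, update_mem_pi_iff, mem_prod, Finset.coe_erase, mem_ofPred_eq, Finset.mem_coe]
  rw [Measure.map_apply measurable_update' (.pi s.countable_toSet fun j _ => ht j), hpre,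
    Measure.prod_prod, Measure.infinitePi_pi μ fun j _ => ht j]
  by_cases hi : i ∈ s
  · simp only [hi, true_imp_iff]
    exact Finset.prod_erase_mul s (fun j => μ j (t j)) hi
  · simp only [hi, false_imp_iff, Set.ofPred_true, measure_univ, mul_one,
      Finset.erase_eq_of_notMem hi]

theorem ofReal_variance_le_lintegral_sq_sub {Ω : Type*} [MeasurableSpace Ω] {P : Measure Ω}
    [IsProbabilityMeasure P] {X : Ω → ℝ} (hX : MemLp X 2 P) (a : ℝ) :
    ENNReal.ofReal Var[X; P] ≤ ∫⁻ ω, ENNReal.ofReal ((X ω - a) ^ 2) ∂P := by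
  have hXa : MemLp (fun ω => X ω - a) 2 P := hX.sub (memLp_const a)
  rw [← ofReal_integral_eq_lintegral_ofReal hXa.integrable_sq (ae_of_all _ fun _ => sq_nonneg _),
    ← variance_sub_const hX.aestronglyMeasurable a]
  exact ENNReal.ofReal_le_ofReal (variance_le_expectation_sq hXa.aestronglyMeasurable)

end Measurability

section GaussianPosterior

theorem measurePreserving_reflection_gaussianReal (θ : ℝ) :
    MeasurePreserving
      (fun p : ℝ × ℝ => (Real.sin θ * p.1 + Real.cos θ * p.2, Real.cos θ * p.1 - Real.sin θ * p.2))
      ((gaussianReal 0 1).prod (gaussianReal 0 1))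
      ((gaussianReal 0 1).prod (gaussianReal 0 1)) := by
  have hrot : MeasurePreserving (ContinuousLinearMap.rotation θ : ℝ × ℝ →L[ℝ] ℝ × ℝ)
      ((gaussianReal 0 1).prod (gaussianReal 0 1)) ((gaussianReal 0 1).prod (gaussianReal 0 1)) :=
    ⟨by fun_prop, IsGaussian.map_rotation_eq_self (μ := gaussianReal 0 1) (by simp) θ⟩
  convert! hrot.comp Measure.measurePreserving_swap using 1
  ext p <;>
    simp only [Function.comp_apply, ContinuousLinearMap.rotation_apply, Prod.fst_swap,
      Prod.snd_swap, smul_eq_mul] <;>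
    ring

theorem sqrt_mul_cos_arg (v s : ℝ≥0) :
    √v * Real.cos (Complex.arg ⟨s, √v⟩) = √(v * s ^ 2 / (v + s ^ 2) : ℝ≥0) := by
  have hnorm : ‖(⟨s, √v⟩ : ℂ)‖ = √(v + s ^ 2 : ℝ≥0) := by
    rw [Complex.norm_def, Complex.normSq_mk, Real.mul_self_sqrt v.coe_nonneg, ← sq, add_comm]
    norm_cast
  obtain hw | hw := eq_or_ne (⟨s, √v⟩ : ℂ) 0
  · obtain ⟨hs, hv⟩ := Complex.ext_iff.1 hw
    obtain rfl : v = 0 := NNReal.coe_eq_zero.1 ((Real.sqrt_eq_zero v.coe_nonneg).1 hv)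
    simp
  · rw [Complex.cos_arg hw, hnorm, NNReal.coe_div, NNReal.coe_mul, Real.sqrt_div (by positivity),
      Real.sqrt_mul v.coe_nonneg, NNReal.coe_pow, Real.sqrt_sq s.coe_nonneg, mul_div_assoc]

variable {𝒴 𝒵 : Type*} [MeasurableSpace 𝒴] [MeasurableSpace 𝒵]

theorem map_prod_eq_map_prodMap {𝒲 : Type*} [MeasurableSpace 𝒲] (ν : Measure 𝒴) [SFinite ν]
    (ρ : Measure 𝒲) [SFinite ρ] {e : 𝒴 → 𝒵} (he : Measurable e) :
    (ν.map e).prod ρ = (ν.prod ρ).map (Prod.map e id) := by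
  rw [← Measure.map_prod_map _ _ he measurable_id, Measure.map_id]

theorem measurePreserving_skew_reflection (ν : Measure 𝒴) [SFinite ν] {θ : 𝒴 → ℝ}
    (hθ : Measurable θ) :
    MeasurePreserving
      (fun p : (𝒴 × ℝ) × ℝ => ((p.1.1, Real.sin (θ p.1.1) * p.1.2 + Real.cos (θ p.1.1) * p.2),
        Real.cos (θ p.1.1) * p.1.2 - Real.sin (θ p.1.1) * p.2))
      ((ν.prod (gaussianReal 0 1)).prod (gaussianReal 0 1))
      ((ν.prod (gaussianReal 0 1)).prod (gaussianReal 0 1)) := by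
  have hskew := (MeasurePreserving.id ν).skew_product
    (g := fun y (z : ℝ × ℝ) => (Real.sin (θ y) * z.1 + Real.cos (θ y) * z.2,
      Real.cos (θ y) * z.1 - Real.sin (θ y) * z.2)) (by fun_prop)
    (ae_of_all _ fun y => (measurePreserving_reflection_gaussianReal (θ y)).map_eq)
  have hassoc := measurePreserving_prodAssoc ν (gaussianReal 0 1) (gaussianReal 0 1)
  exact (hassoc.symm _).comp (hskew.comp hassoc)

/-- The joint law `J` of a real parameter and of data in `𝒴` is such that, given the data `y`, the
parameter is normal with mean `m y` and variance `v y`. The regular conditional distribution is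
encoded by the representation of the parameter as `m y + √(v y) z`, with `z` standard normal and
independent of the data. -/
structure HasGaussianPosterior (J : Measure (ℝ × 𝒴)) (m : 𝒴 → ℝ) (v : 𝒴 → ℝ≥0) : Prop where
  measurable_mean : Measurable m
  measurable_var : Measurable v
  eq_map : J = (J.snd.prod (gaussianReal 0 1)).map fun p => (m p.1 + √(v p.1) * p.2, p.1)

/-- The joint law of the parameter and of the data extended by a noisy observation of the parameter
with precision `s y`, where `J` is the joint law of the parameter and of the data `y`. -/
noncomputable def withObservation (J : Measure (ℝ × 𝒴)) (s : 𝒴 → ℝ≥0) : Measure (ℝ × 𝒴 × ℝ) :=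
  (J.prod (gaussianReal 0 1)).map fun p => (p.1.1, p.1.2, p.1.1 + s p.1.2 * p.2)

instance (J : Measure (ℝ × 𝒴)) [SFinite J] (s : 𝒴 → ℝ≥0) : SFinite (withObservation J s) := by
  unfold withObservation; infer_instance

namespace HasGaussianPosterior

variable {J : Measure (ℝ × 𝒴)} {m : 𝒴 → ℝ} {v : 𝒴 → ℝ≥0}

theorem of_eq_map {ν : Measure 𝒴} [SFinite ν] (hm : Measurable m) (hv : Measurable v)
    (hJ : J = (ν.prod (gaussianReal 0 1)).map fun p => (m p.1 + √(v p.1) * p.2, p.1)) :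
    HasGaussianPosterior J m v := by
  have hν : J.snd = ν := by
    rw [hJ, Measure.snd, Measure.map_map measurable_snd (by fun_prop)]
    exact Measure.fst_prod
  exact ⟨hm, hv, hν ▸ hJ⟩

theorem map [SFinite J] {e : 𝒴 → 𝒵} (he : Measurable e) {m : 𝒵 → ℝ} {v : 𝒵 → ℝ≥0}
    (hm : Measurable m) (hv : Measurable v) (h : HasGaussianPosterior J (m ∘ e) (v ∘ e)) :
    HasGaussianPosterior (J.map (Prod.map id e)) m v := by
  refine of_eq_map (ν := J.snd.map e) hm hv ?_
  rw [map_prod_eq_map_prodMap _ _ he, Measure.map_map (by fun_prop) (by fun_prop)]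
  conv_lhs => rw [h.eq_map, Measure.map_map (by fun_prop)
    (by have := h.measurable_mean; have := h.measurable_var; fun_prop)]
  rfl

theorem restrict [SFinite J] (h : HasGaussianPosterior J m v) {A : Set 𝒴} (hA : MeasurableSet A) :
    HasGaussianPosterior (J.restrict (Prod.snd ⁻¹' A)) m v := by
  have hm := h.measurable_mean
  have hv := h.measurable_var
  refine of_eq_map (ν := J.snd.restrict A) hm hv ?_
  conv_lhs => rw [h.eq_map, Measure.restrict_map (by fun_prop) (measurable_snd hA)]
  rw [← Measure.restrict_univ (μ := gaussianReal 0 1), Measure.prod_restrict, prod_univ,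
    Measure.restrict_univ]
  rfl

theorem sum {ι : Type*} [Countable ι] {J : ι → Measure (ℝ × 𝒴)} [∀ i, SFinite (J i)]
    (hm : Measurable m) (hv : Measurable v) (h : ∀ i, HasGaussianPosterior (J i) m v) :
    HasGaussianPosterior (Measure.sum J) m v := by
  refine of_eq_map (ν := Measure.sum fun i => (J i).snd) hm hv ?_
  rw [Measure.prod_sum_left, Measure.map_sum (by fun_prop)]
  exact congr_arg Measure.sum (funext fun i => (h i).eq_map)

theorem lintegral_var_le [SFinite J] (h : HasGaussianPosterior J m v) {Φ : 𝒴 → ℝ}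
    (hΦ : Measurable Φ) :
    ∫⁻ p, v p.2 ∂J ≤ ∫⁻ p, ENNReal.ofReal ((p.1 - Φ p.2) ^ 2) ∂J := by
  have hm := h.measurable_mean
  have hv := h.measurable_var
  have hvar : ∀ y, Var[fun z => m y + √(v y) * z; gaussianReal 0 1] = v y := fun y => by
    rw [variance_const_add (by fun_prop), variance_const_mul, variance_fun_id_gaussianReal,
      Real.sq_sqrt (v y).coe_nonneg, NNReal.coe_one, mul_one]
  have hL2 : ∀ y, MemLp (fun z => m y + √(v y) * z) 2 (gaussianReal 0 1) := fun y =>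
    (memLp_const (m y)).add ((memLp_id_gaussianReal 2).const_mul √(v y))
  rw [h.eq_map, lintegral_map (by fun_prop) (by fun_prop),
    lintegral_map (by fun_prop) (by fun_prop), lintegral_prod _ (by fun_prop),
    lintegral_prod _ (by fun_prop)]
  refine lintegral_mono fun y => ?_
  calc ∫⁻ _, (v y : ℝ≥0∞) ∂gaussianReal 0 1
      = ENNReal.ofReal Var[fun z => m y + √(v y) * z; gaussianReal 0 1] := by
        rw [lintegral_const, measure_univ, mul_one, hvar, ENNReal.ofReal_coe_nnreal]
    _ ≤ ∫⁻ z, ENNReal.ofReal ((m y + √(v y) * z - Φ y) ^ 2) ∂gaussianReal 0 1 :=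
        ofReal_variance_le_lintegral_sq_sub (hL2 y) (Φ y)

theorem exists_withObservation [SFinite J] (h : HasGaussianPosterior J m v) {s : 𝒴 → ℝ≥0}
    (hs : Measurable s) :
    ∃ m' : 𝒴 × ℝ → ℝ, HasGaussianPosterior (withObservation J s) m'
      fun y => v y.1 * s y.1 ^ 2 / (v y.1 + s y.1 ^ 2) := by
  have hm := h.measurable_mean
  have hv := h.measurable_var
  -- After a reflection of angle `arg (s + i√v)` the observation is `m + ‖s + i√v‖ q`, and the
  -- parameter is a function of `q` and of an independent normal variable.
  set w : 𝒴 → ℂ := fun y => ⟨s y, √(v y)⟩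
  have hw : Measurable w :=
    Complex.measurableEquivRealProd.symm.measurable.comp (by fun_prop : Measurable fun y =>
      ((s y : ℝ), √(v y)))
  set θ : 𝒴 → ℝ := fun y => (w y).arg
  have hθ : Measurable θ := Complex.measurable_arg.comp hw
  have hcos : ∀ y, ‖w y‖ * Real.cos (θ y) = s y := fun y => Complex.norm_mul_cos_arg _
  have hsin : ∀ y, ‖w y‖ * Real.sin (θ y) = √(v y) := fun y => Complex.norm_mul_sin_arg _
  have hcos_sq : ∀ y, Real.cos (θ y) ^ 2 = 1 - Real.sin (θ y) ^ 2 := fun y => Real.cos_sq' _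
  have hR := measurePreserving_skew_reflection J.snd hθ
  refine ⟨fun y => Real.cos (θ y.1) ^ 2 * m y.1 + Real.sin (θ y.1) ^ 2 * y.2,
    of_eq_map (ν := (J.snd.prod (gaussianReal 0 1)).map fun p => (p.1, m p.1 + ‖w p.1‖ * p.2))
      (by fun_prop) (by fun_prop) ?_⟩
  rw [withObservation, map_prod_eq_map_prodMap _ _ (by fun_prop),
    Measure.map_map (by fun_prop) (by fun_prop)]
  conv_lhs =>
    rw [h.eq_map, map_prod_eq_map_prodMap _ _ (by fun_prop),
      Measure.map_map (by fun_prop) (by fun_prop), ← hR.map_eq,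
      Measure.map_map (by fun_prop) hR.measurable]
  congr 1
  ext p
  · simp only [Function.comp_apply, Prod.map_fst, Prod.map_snd, id, ← sqrt_mul_cos_arg]
    change _ = _ + √(v p.1.1) * Real.cos (θ p.1.1) * p.2
    rw [← hsin, hcos_sq]
    ring
  · rfl
  · simp only [Function.comp_apply, Prod.map_fst, Prod.map_snd, id]
    rw [← hsin, ← hcos]
    linear_combination ‖w p.1.1‖ * p.1.2 * Real.sin_sq_add_cos_sq (θ p.1.1)

end HasGaussianPosterior

end GaussianPosterior

/-- The distribution of the noise, a sequence of independent standard Gaussian variables. -/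
noncomputable abbrev gaussianNoise : Measure (ℕ → ℝ) :=
  Measure.infinitePi fun _ : ℕ => gaussianReal 0 1

namespace AdaptiveInfo

variable (N : AdaptiveInfo)

@[fun_prop]
theorem measurable_obs (n : ℕ) : Measurable fun p : ℝ × (ℕ → ℝ) => N.obs p.1 p.2 n := by
  induction n using Nat.strong_induction_on with
  | _ n ih =>
    have hprec : Measurable fun p : ℝ × (ℕ → ℝ) => N.prec n fun i : Fin n => N.obs p.1 p.2 i :=
      (N.measurable_prec n).comp (measurable_pi_lambda _ fun i => ih i i.2)
    have hobs : ∀ p : ℝ × (ℕ → ℝ), N.obs p.1 p.2 n =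
        p.1 + (N.prec n fun i : Fin n => N.obs p.1 p.2 i) * p.2 n := fun p => by rw [obs]
    rw [funext hobs]
    fun_prop

theorem obs_update_of_lt (f : ℝ) (ξ : ℕ → ℝ) (t : ℝ) {i n : ℕ} (hi : i < n) :
    N.obs f (Function.update ξ n t) i = N.obs f ξ i := by
  induction i using Nat.strong_induction_on with
  | _ i ih =>
    have hprev : (fun j : Fin i => N.obs f (Function.update ξ n t) j) =
        fun j : Fin i => N.obs f ξ j := funext fun j => ih j j.2 (j.2.trans hi)
    rw [obs, obs, hprev, Function.update_of_ne hi.ne]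

theorem stopped_mem_range (y : ℕ → ℝ) : N.stopped y ∈ N.range :=
  (N.existsUnique_length y).choose_spec.1

theorem length_eq_iff {y : ℕ → ℝ} {n : ℕ} :
    N.length y = n ↔ (⟨n, fun i => y i⟩ : FinSeq) ∈ N.range :=
  ⟨fun h => h ▸ N.stopped_mem_range y,
    fun h => ((N.existsUnique_length y).choose_spec.2 n h).symm⟩

theorem stopped_eq_of_mem_range {y : ℕ → ℝ} {n : ℕ} (h : (⟨n, fun i => y i⟩ : FinSeq) ∈ N.range) :
    N.stopped y = ⟨n, fun i => y i⟩ := by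
  obtain rfl := N.length_eq_iff.2 h
  rfl

/-- The values `(y₁,…,yₙ)` of the first `n` observations at which the process stops. -/
def stopSet (n : ℕ) : Set (Fin n → ℝ) := {y | (⟨n, y⟩ : FinSeq) ∈ N.range}

theorem measurableSet_stopSet (n : ℕ) : MeasurableSet (N.stopSet n) :=
  measurable_sigmaMk n N.measurableSet_range

theorem measurable_length : Measurable N.length := by
  refine measurable_to_countable' fun n => ?_
  have hpre : N.length ⁻¹' {n} = (fun y (i : Fin n) => y i) ⁻¹' N.stopSet n :=
    Set.ext fun y => N.length_eq_iff
  rw [hpre]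
  exact (by fun_prop : Measurable fun (y : ℕ → ℝ) (i : Fin n) => y i) (N.measurableSet_stopSet n)

@[fun_prop]
theorem measurable_stopped : Measurable N.stopped := by
  intro S hS
  have hpre : N.stopped ⁻¹' S = ⋃ n, N.length ⁻¹' {n} ∩
      (fun y => (⟨n, fun i : Fin n => y i⟩ : FinSeq)) ⁻¹' S := by
    ext y
    simp only [mem_preimage, mem_iUnion, mem_inter_iff, mem_singleton_iff, exists_eq_left']
    rfl
  rw [hpre]
  refine .iUnion fun n => (N.measurable_length (measurableSet_singleton n)).inter ?_
  exact ((measurable_sigmaMk n).comp (by fun_prop)) hS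

/-- The joint law of the parameter and of the first `n` observations, when the parameter has
distribution `ρ`. The stopping rule is ignored. -/
noncomputable def joint (ρ : Measure ℝ) (n : ℕ) : Measure (ℝ × (Fin n → ℝ)) :=
  (ρ.prod gaussianNoise).map fun p => (p.1, fun i => N.obs p.1 p.2 i)

/-- The joint law of the parameter and of the information, when the parameter has
distribution `ρ`. -/
noncomputable def stoppedJoint (ρ : Measure ℝ) : Measure (ℝ × FinSeq) :=
  (ρ.prod gaussianNoise).map fun p => (p.1, N.stopped (N.obs p.1 p.2))

@[fun_prop]
theorem measurable_stopped_obs_uncurry :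
    Measurable fun p : ℝ × (ℕ → ℝ) => N.stopped (N.obs p.1 p.2) :=
  N.measurable_stopped.comp (measurable_pi_lambda _ fun n => N.measurable_obs n)

instance (ρ : Measure ℝ) [SFinite ρ] (n : ℕ) : SFinite (N.joint ρ n) := by
  unfold joint; infer_instance

instance (ρ : Measure ℝ) [SFinite ρ] : SFinite (N.stoppedJoint ρ) := by
  unfold stoppedJoint; infer_instance

theorem joint_succ (ρ : Measure ℝ) [SFinite ρ] (n : ℕ) :
    N.joint ρ (n + 1) =
      (withObservation (N.joint ρ n) (N.prec n)).map (Prod.map id fun y => Fin.snoc y.1 y.2) := by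
  have hprec := N.measurable_prec n
  have hsnoc := measurable_finSnoc (α := ℝ) (n := n)
  have hnoise : ρ.prod gaussianNoise = ((ρ.prod gaussianNoise).prod (gaussianReal 0 1)).map
      fun p => (p.1.1, Function.update p.1.2 n p.2) := by
    conv_lhs =>
      rw [gaussianNoise, ← map_update_infinitePi (fun _ : ℕ => gaussianReal 0 1) n,
        ← Measure.map_id (μ := ρ), Measure.map_prod_map _ _ measurable_id (by fun_prop),
        ← Measure.prodAssoc_prod, Measure.map_map (by fun_prop) (by fun_prop)]
    rfl
  rw [joint, hnoise, Measure.map_map (by fun_prop) (by fun_prop), withObservation, joint,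
    map_prod_eq_map_prodMap _ _ (by fun_prop), Measure.map_map (by fun_prop) (by fun_prop),
    Measure.map_map (by fun_prop) (by fun_prop)]
  congr 1
  ext p i
  · rfl
  · induction i using Fin.lastCases with
    | last =>
      simp only [Function.comp_apply, Fin.val_last, Prod.map_snd, Fin.snoc_last, Prod.map_fst, id]
      rw [obs, Function.update_self]
      simp only [obs_update_of_lt _ _ _ _ (Fin.is_lt _)]
    | cast i =>
      simp only [Function.comp_apply, Prod.map_snd, Prod.map_fst, Fin.snoc_castSucc,
        Fin.val_castSucc, obs_update_of_lt _ _ _ _ (Fin.is_lt _)]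

theorem stoppedJoint_eq_sum (ρ : Measure ℝ) [SFinite ρ] :
    N.stoppedJoint ρ = Measure.sum fun n =>
      ((N.joint ρ n).restrict (Prod.snd ⁻¹' N.stopSet n)).map
        (Prod.map id fun y => ⟨n, y⟩) := by
  have hmk := fun n => measurable_sigmaMk (β := fun n : ℕ => Fin n → ℝ) n
  set L : ℝ × (ℕ → ℝ) → ℕ := fun p => N.length (N.obs p.1 p.2)
  have hL : ∀ n, MeasurableSet (L ⁻¹' {n}) := fun n =>
    (N.measurable_length.comp (measurable_pi_lambda _ fun n => N.measurable_obs n))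
      (measurableSet_singleton n)
  have hsplit : ρ.prod gaussianNoise =
      Measure.sum fun n => (ρ.prod gaussianNoise).restrict (L ⁻¹' {n}) := by
    rw [← Measure.restrict_iUnion (fun i j hij => (disjoint_singleton.2 hij).preimage L) hL,
      ← preimage_iUnion, iUnion_of_singleton, preimage_univ, Measure.restrict_univ]
  rw [stoppedJoint, hsplit, Measure.map_sum (by fun_prop)]
  congr 1
  funext n
  rw [joint, Measure.restrict_map (by fun_prop) (measurable_snd (N.measurableSet_stopSet n)),
    Measure.map_map (by fun_prop) (by fun_prop)]
  have hpre : L ⁻¹' {n} = (fun p : ℝ × (ℕ → ℝ) => (p.1, fun i : Fin n => N.obs p.1 p.2 i)) ⁻¹'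
      (Prod.snd ⁻¹' N.stopSet n) := Set.ext fun p => N.length_eq_iff
  rw [← hpre]
  refine Measure.map_congr ?_
  filter_upwards [ae_restrict_mem (hL n)] with p hp
  rw [N.stopped_eq_of_mem_range (N.length_eq_iff.1 hp)]
  rfl

theorem lintegral_stoppedJoint (ρ : Measure ℝ) [SFinite ρ] {F : ℝ × FinSeq → ℝ≥0∞}
    (hF : Measurable F) :
    ∫⁻ p, F p ∂N.stoppedJoint ρ = ∫⁻ f, ∫⁻ y, F (f, y) ∂N.law f ∂ρ := by
  rw [stoppedJoint, lintegral_map hF (by fun_prop), lintegral_prod _ (by fun_prop)]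
  refine lintegral_congr fun f => ?_
  rw [law, lintegral_map (by fun_prop) (N.measurable_stopped_obs f)]

theorem ae_stoppedJoint_mem_range (ρ : Measure ℝ) : ∀ᵐ p ∂N.stoppedJoint ρ, p.2 ∈ N.range :=
  (ae_map_iff (by fun_prop) (measurable_snd N.measurableSet_range)).2
    (ae_of_all _ fun p => N.stopped_mem_range _)

end AdaptiveInfo

theorem coe_mul_div_add_eq_inv_add_inv (v w : ℝ≥0) :
    ((v * w / (v + w) : ℝ≥0) : ℝ≥0∞) = ((v : ℝ≥0∞)⁻¹ + (w : ℝ≥0∞)⁻¹)⁻¹ := by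
  obtain rfl | hv := eq_or_ne v 0
  · simp
  obtain rfl | hw := eq_or_ne w 0
  · simp
  rw [← ENNReal.coe_inv hv, ← ENNReal.coe_inv hw, ← ENNReal.coe_add,
    ← ENNReal.coe_inv (by positivity), add_comm v w]
  congr 1
  field_simp

namespace AdaptiveInfo

variable (N : AdaptiveInfo)

/-- The precision `σᵢ₊₁(y₁,…,yᵢ)` with which the entry of index `i` of the information `y` has been
observed. -/
def precAt (y : FinSeq) (i : Fin y.1) : ℝ≥0 := N.prec i fun j => y.2 (j.castLE i.2.le)

/-- The Fisher information `∑ᵢ σᵢ⁻²` of the observations leading to `y`; it is infinite as soon as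
one of them is exact. -/
noncomputable def information (y : FinSeq) : ℝ≥0∞ := ∑ i, ((N.precAt y i : ℝ≥0∞) ^ 2)⁻¹

theorem information_zero (y : Fin 0 → ℝ) : N.information ⟨0, y⟩ = 0 := Finset.sum_empty

theorem information_snoc {n : ℕ} (y : Fin n → ℝ) (t : ℝ) :
    N.information ⟨n + 1, Fin.snoc y t⟩ = N.information ⟨n, y⟩ + ((N.prec n y : ℝ≥0∞) ^ 2)⁻¹ := by
  have hinit : ∀ i : Fin n,
      N.precAt ⟨n + 1, Fin.snoc y t⟩ i.castSucc = N.precAt ⟨n, y⟩ i := fun i => by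
    refine congr_arg (N.prec i) (funext fun j => ?_)
    exact Fin.snoc_castSucc (α := fun _ => ℝ) t y (j.castLE i.2.le)
  have hlast : N.precAt ⟨n + 1, Fin.snoc y t⟩ (Fin.last n) = N.prec n y :=
    congr_arg (N.prec n) (funext fun j => Fin.snoc_castSucc (α := fun _ => ℝ) t y j)
  rw [information, Fin.sum_univ_castSucc, hlast]
  simp only [hinit]
  rfl

theorem measurable_sum_precAt {g : ℝ≥0 → ℝ≥0∞} (hg : Measurable g) :
    Measurable fun y : FinSeq => ∑ i, g (N.precAt y i) := by
  refine measurable_of_comp_sigmaMk fun n => ?_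
  change Measurable fun y : Fin n → ℝ => ∑ i : Fin n, g (N.precAt ⟨n, y⟩ i)
  exact Finset.measurable_fun_sum _ fun i _ => hg.comp ((N.measurable_prec i).comp
    (measurable_pi_lambda _ fun j => measurable_pi_apply (j.castLE i.2.le)))

@[fun_prop]
theorem measurable_information : Measurable N.information :=
  N.measurable_sum_precAt (g := fun s => ((s : ℝ≥0∞) ^ 2)⁻¹) (by fun_prop)

/-- The posterior variance of the parameter given the information `y`, for a centered Gaussian
prior with variance `lam`. It depends on `y` only through the precisions. -/
noncomputable def posteriorVar (lam : ℝ≥0) (y : FinSeq) : ℝ≥0∞ :=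
  ((lam : ℝ≥0∞)⁻¹ + N.information y)⁻¹

@[fun_prop]
theorem measurable_posteriorVar (lam : ℝ≥0) : Measurable (N.posteriorVar lam) := by
  unfold posteriorVar; fun_prop

theorem posteriorVar_le (lam : ℝ≥0) (y : FinSeq) : N.posteriorVar lam y ≤ lam :=
  ENNReal.inv_le_iff_inv_le.2 le_self_add

theorem coe_toNNReal_posteriorVar (lam : ℝ≥0) (y : FinSeq) :
    ((N.posteriorVar lam y).toNNReal : ℝ≥0∞) = N.posteriorVar lam y :=
  ENNReal.coe_toNNReal (ne_top_of_le_ne_top ENNReal.coe_ne_top (N.posteriorVar_le lam y))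

theorem posteriorVar_snoc (lam : ℝ≥0) {n : ℕ} (y : Fin n → ℝ) (t : ℝ) :
    (N.posteriorVar lam ⟨n + 1, Fin.snoc y t⟩).toNNReal =
      (N.posteriorVar lam ⟨n, y⟩).toNNReal * N.prec n y ^ 2 /
        ((N.posteriorVar lam ⟨n, y⟩).toNNReal + N.prec n y ^ 2) := by
  rw [← ENNReal.coe_inj, coe_mul_div_add_eq_inv_add_inv, coe_toNNReal_posteriorVar,
    coe_toNNReal_posteriorVar, posteriorVar, posteriorVar, inv_inv, information_snoc, add_assoc,
    ENNReal.coe_pow]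

theorem hasGaussianPosterior_joint_zero (lam : ℝ≥0) :
    HasGaussianPosterior (N.joint (gaussianReal 0 lam) 0) (fun _ => 0) fun _ => lam := by
  refine .of_eq_map (ν := Measure.dirac default) measurable_const measurable_const ?_
  have hscale : gaussianReal 0 lam = (gaussianReal 0 1).map (√lam * ·) := by
    rw [gaussianReal_map_const_mul, mul_zero, mul_one]
    congr
    exact NNReal.eq (Real.sq_sqrt lam.coe_nonneg).symm
  have hjoint : N.joint (gaussianReal 0 lam) 0 = (gaussianReal 0 lam).map (·, default) := by
    have hfst : ∀ p : ℝ × (ℕ → ℝ), (p.1, fun i : Fin 0 => N.obs p.1 p.2 i) =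
        ((·, default) ∘ Prod.fst) p := fun p => Prod.ext rfl (Subsingleton.elim _ _)
    rw [joint, funext hfst, ← Measure.map_map (by fun_prop) (by fun_prop)]
    exact congr_arg _ Measure.fst_prod
  rw [hjoint, hscale, Measure.map_map (by fun_prop) (by fun_prop), Measure.dirac_prod,
    Measure.map_map (by fun_prop) (by fun_prop)]
  congr 1
  funext z
  simp

theorem exists_hasGaussianPosterior_joint (lam : ℝ≥0) (n : ℕ) :
    ∃ m, HasGaussianPosterior (N.joint (gaussianReal 0 lam) n) m
      fun y => (N.posteriorVar lam ⟨n, y⟩).toNNReal := by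
  induction n with
  | zero =>
    refine ⟨fun _ => 0, ?_⟩
    simpa only [posteriorVar, information_zero, add_zero, inv_inv, ENNReal.toNNReal_coe] using
      N.hasGaussianPosterior_joint_zero lam
  | succ n ih =>
    obtain ⟨m, hm⟩ := ih
    obtain ⟨m', hm'⟩ := hm.exists_withObservation (N.measurable_prec n)
    have := hm'.measurable_mean
    rw [N.joint_succ]
    refine ⟨fun y => m' (Fin.init y, y (Fin.last n)), .map measurable_finSnoc ?_ ?_ ?_⟩
    · refine this.comp (.prodMk ?_ (by fun_prop))
      exact measurable_pi_lambda _ fun i => measurable_pi_apply _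
    · exact ((N.measurable_posteriorVar lam).comp (measurable_sigmaMk _)).ennreal_toNNReal
    · convert hm' using 1
      · funext p
        simp
      · funext p
        exact N.posteriorVar_snoc lam p.1 p.2

theorem exists_hasGaussianPosterior_stoppedJoint (lam : ℝ≥0) :
    ∃ m, HasGaussianPosterior (N.stoppedJoint (gaussianReal 0 lam)) m
      fun y => (N.posteriorVar lam y).toNNReal := by
  choose m hm using N.exists_hasGaussianPosterior_joint lam
  have hmean : Measurable fun y : FinSeq => m y.1 y.2 :=
    measurable_of_comp_sigmaMk fun n => (hm n).measurable_mean
  have hvar : Measurable fun y => (N.posteriorVar lam y).toNNReal := by fun_prop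
  rw [N.stoppedJoint_eq_sum]
  refine ⟨fun y => m y.1 y.2, HasGaussianPosterior.sum hmean hvar fun n => ?_⟩
  exact ((hm n).restrict (N.measurableSet_stopSet n)).map (measurable_sigmaMk n) hmean hvar

theorem lintegral_posteriorVar_le (lam : ℝ≥0) {Φ : FinSeq → ℝ} (hΦ : Measurable Φ) :
    ∫⁻ p, N.posteriorVar lam p.2 ∂N.stoppedJoint (gaussianReal 0 lam) ≤
      ∫⁻ p, ENNReal.ofReal ((p.1 - Φ p.2) ^ 2) ∂N.stoppedJoint (gaussianReal 0 lam) := by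
  obtain ⟨m, hm⟩ := N.exists_hasGaussianPosterior_stoppedJoint lam
  simpa only [coe_toNNReal_posteriorVar] using hm.lintegral_var_le hΦ

theorem error_le_iff {Φ : FinSeq → ℝ} {σ : ℝ≥0} :
    N.error Φ ≤ σ ↔ ∀ f, ∫⁻ y, ENNReal.ofReal ((f - Φ y) ^ 2) ∂N.law f ≤ (σ : ℝ≥0∞) ^ 2 := by
  rw [error, iSup_le_iff]
  refine forall_congr' fun f => ?_
  rw [one_div, ENNReal.rpow_inv_le_iff two_pos, ENNReal.rpow_two]

theorem measurable_pathCost (c : CostFunction) (d : ℕ+) : Measurable (N.pathCost c d) :=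
  N.measurable_sum_precAt (c.antitone_prec d).measurable

theorem le_cost_add_mul_of_forall_le {Φ : FinSeq → ℝ} (hΦ : Measurable Φ) {σ : ℝ≥0}
    (he : N.error Φ ≤ σ) {c : CostFunction} {d : ℕ+} {lam : ℝ≥0} {a k : ℝ≥0∞}
    (h : ∀ y ∈ N.range, a ≤ N.pathCost c d y + k * N.posteriorVar lam y) :
    a ≤ N.cost c d + k * σ ^ 2 := by
  set ρ := gaussianReal 0 lam
  have hcost : Measurable fun p : ℝ × FinSeq => N.pathCost c d p.2 :=
    (N.measurable_pathCost c d).comp measurable_snd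
  have hmean : ∀ {g : ℝ → ℝ≥0∞} {b : ℝ≥0∞}, (∀ f, g f ≤ b) → ∫⁻ f, g f ∂ρ ≤ b := fun hg =>
    (lintegral_mono hg).trans_eq (by rw [lintegral_const, measure_univ, mul_one])
  have hmass : N.stoppedJoint ρ univ = 1 := by
    rw [stoppedJoint, Measure.map_apply (by fun_prop) .univ, preimage_univ, measure_univ]
  calc a = ∫⁻ _, a ∂N.stoppedJoint ρ := by rw [lintegral_const, hmass, mul_one]
    _ ≤ ∫⁻ p, N.pathCost c d p.2 + k * N.posteriorVar lam p.2 ∂N.stoppedJoint ρ :=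
        lintegral_mono_ae ((N.ae_stoppedJoint_mem_range ρ).mono fun p hp => h p.2 hp)
    _ = (∫⁻ p, N.pathCost c d p.2 ∂N.stoppedJoint ρ) +
          k * ∫⁻ p, N.posteriorVar lam p.2 ∂N.stoppedJoint ρ := by
        rw [lintegral_add_left hcost, lintegral_const_mul _ (by fun_prop)]
    _ ≤ N.cost c d + k * σ ^ 2 := by
        refine add_le_add ?_ (mul_le_mul_right ((N.lintegral_posteriorVar_le lam hΦ).trans ?_) k)
        · rw [N.lintegral_stoppedJoint ρ hcost]
          exact hmean (le_iSup fun f => ∫⁻ y, N.pathCost c d y ∂N.law f)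
        · rw [N.lintegral_stoppedJoint ρ (by fun_prop)]
          exact hmean (N.error_le_iff.1 he)

theorem length_pos_of_error_le {Φ : FinSeq → ℝ} (hΦ : Measurable Φ) {σ : ℝ≥0}
    (he : N.error Φ ≤ σ) {y : FinSeq} (hy : y ∈ N.range) : 0 < y.1 := by
  by_contra! hlen
  obtain ⟨n, y⟩ := y
  obtain rfl : n = 0 := Nat.le_zero.1 hlen
  have hstopped : ∀ z, N.stopped z = ⟨0, y⟩ := fun z => by
    rw [Subsingleton.elim y fun i => z i] at hy ⊢
    exact N.stopped_eq_of_mem_range hy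
  have hlaw : ∀ f, N.law f = .dirac ⟨0, y⟩ := fun f => by
    rw [law, funext fun ξ => hstopped (N.obs f ξ), Measure.map_const, measure_univ, one_smul]
  have hfar := N.error_le_iff.1 he (Φ ⟨0, y⟩ + (σ + 1))
  rw [hlaw, lintegral_dirac' _ (by fun_prop), add_sub_cancel_left,
    ENNReal.ofReal_pow (by positivity), ← NNReal.coe_one, ← NNReal.coe_add,
    ENNReal.ofReal_coe_nnreal] at hfar
  norm_cast at hfar
  exact absurd (le_of_pow_le_pow_left₀ two_ne_zero zero_le hfar) (by simp)

end AdaptiveInfo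

theorem lintegral_sq_sum_of_pairwise_indepFun {Ω ι : Type*} {mΩ : MeasurableSpace Ω}
    {P : Measure Ω} [IsFiniteMeasure P] [Fintype ι] {X : ι → Ω → ℝ} (hX : ∀ i, MemLp (X i) 2 P)
    (hmean : ∀ i, P[X i] = 0) (hindep : Pairwise fun i j => X i ⟂ᵢ[P] X j) :
    ∫⁻ ω, ENNReal.ofReal ((∑ i, X i ω) ^ 2) ∂P = ENNReal.ofReal (∑ i, Var[X i; P]) := by
  have hmean_sum : ∫ ω, ∑ i, X i ω ∂P = 0 := by
    simp only [integral_finsetSum _ fun i _ => (hX i).integrable one_le_two,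
      hmean, Finset.sum_const_zero]
  rw [← IndepFun.variance_sum (fun i _ => hX i) (hindep.set_pairwise _),
    (memLp_finsetSum' _ fun i _ => hX i).ofReal_variance_eq, evariance_eq_lintegral_ofReal]
  simp only [Finset.sum_apply, hmean_sum, sub_zero]

theorem lintegral_sq_sum_gaussianNoise (n : ℕ) :
    ∫⁻ ξ, ENNReal.ofReal ((∑ i : Fin n, ξ i) ^ 2) ∂gaussianNoise = n := by
  have hlaw : ∀ i, HasLaw (fun ξ : ℕ → ℝ => ξ i) (gaussianReal 0 1) gaussianNoise := fun i =>
    (measurePreserving_eval_infinitePi (fun _ => gaussianReal 0 1) i).hasLaw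
  have hindep : iIndepFun (fun (i : ℕ) (ξ : ℕ → ℝ) => ξ i) gaussianNoise :=
    iIndepFun_infinitePi (X := fun _ t => t) fun _ => measurable_id
  have hvar : ∀ i, Var[fun ξ : ℕ → ℝ => ξ i; gaussianNoise] = 1 := fun i => by
    rw [(hlaw i).variance_eq, variance_id_gaussianReal, NNReal.coe_one]
  rw [lintegral_sq_sum_of_pairwise_indepFun (X := fun (i : Fin n) (ξ : ℕ → ℝ) => ξ i)
    (fun i => (memLp_id_gaussianReal 2).comp_measurePreserving
      (measurePreserving_eval_infinitePi _ _))
    (fun i => (hlaw i).integral_eq.trans integral_id_gaussianReal)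
    fun i j hij => hindep.indepFun (Fin.val_injective.ne hij)]
  simp only [hvar, Finset.sum_const, Finset.card_univ, Fintype.card_fin, nsmul_eq_mul, mul_one,
    ENNReal.ofReal_natCast]

namespace AdaptiveInfo

/-- Nonadaptive information: `n` observations, all of them with precision `σ₀`. -/
noncomputable def repeated (n : ℕ) (σ₀ : ℝ≥0) : AdaptiveInfo where
  prec _ _ := σ₀
  measurable_prec _ := measurable_const
  range := {y | y.1 = n}
  measurableSet_range :=
    measurable_of_comp_sigmaMk (g := fun y : FinSeq => y.1) (fun _ => measurable_const)
      (measurableSet_singleton n)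
  existsUnique_length _ := ⟨n, rfl, fun _ h => h⟩

theorem law_repeated (n : ℕ) (σ₀ : ℝ≥0) (f : ℝ) :
    (repeated n σ₀).law f = gaussianNoise.map fun ξ => ⟨n, fun i => f + σ₀ * ξ i⟩ := by
  have hobs : ∀ ξ, (repeated n σ₀).obs f ξ = fun i => f + σ₀ * ξ i := fun ξ => by
    funext i
    rw [obs]
    rfl
  rw [law]
  simp only [hobs]
  congr
  funext ξ
  exact stopped_eq_of_mem_range _ rfl

theorem cost_repeated_le (n : ℕ) (σ₀ : ℝ≥0) (c : CostFunction) (d : ℕ+) :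
    (repeated n σ₀).cost c d ≤ n * c σ₀ d := by
  refine iSup_le fun f => ?_
  rw [law_repeated]
  refine (lintegral_map_le _ _).trans (le_of_eq ?_)
  have hpath : ∀ ξ : ℕ → ℝ,
      (repeated n σ₀).pathCost c d ⟨n, fun i => f + σ₀ * ξ i⟩ = n * c σ₀ d := fun ξ => by
    simp only [pathCost, repeated, Finset.sum_const, Finset.card_univ, Fintype.card_fin,
      nsmul_eq_mul]
  simp only [hpath, lintegral_const, measure_univ, mul_one]

end AdaptiveInfo

/-- The arithmetic mean of a finite sequence; it is `0` for the empty one, by division by zero. -/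
noncomputable def sampleMean (y : FinSeq) : ℝ := (∑ i, y.2 i) / y.1

@[fun_prop]
theorem measurable_sampleMean : Measurable sampleMean :=
  measurable_of_comp_sigmaMk fun n =>
    (by fun_prop : Measurable fun y : Fin n → ℝ => (∑ i, y i) / (n : ℝ))

namespace AdaptiveInfo

theorem error_repeated_sampleMean_le {n : ℕ} (hn : 0 < n) {σ₀ σ : ℝ≥0} (h : σ₀ ^ 2 ≤ n * σ ^ 2) :
    (repeated n σ₀).error sampleMean ≤ σ := by
  refine error_le_iff _ |>.2 fun f => ?_
  have hn' : (n : ℝ≥0) ≠ 0 := by positivity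
  have hdev : ∀ ξ : ℕ → ℝ, ENNReal.ofReal ((f - sampleMean ⟨n, fun i => f + σ₀ * ξ i⟩) ^ 2) =
      ((σ₀ / n) ^ 2 : ℝ≥0) * ENNReal.ofReal ((∑ i : Fin n, ξ i) ^ 2) := fun ξ => by
    have hn'' : (n : ℝ) ≠ 0 := by positivity
    rw [← ENNReal.ofReal_coe_nnreal, ← ENNReal.ofReal_mul (by positivity), sampleMean,
      Finset.sum_add_distrib, ← Finset.mul_sum, Finset.sum_const, Finset.card_univ,
      Fintype.card_fin, nsmul_eq_mul]
    congr 1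
    push_cast
    field_simp
    ring
  rw [law_repeated]
  refine (lintegral_map_le _ _).trans ?_
  simp only [hdev]
  rw [lintegral_const_mul _ (by fun_prop), lintegral_sq_sum_gaussianNoise]
  have hratio : (σ₀ / n) ^ 2 * n ≤ σ ^ 2 := by
    rw [div_pow, sq (n : ℝ≥0), div_mul_eq_mul_div, mul_div_mul_right _ _ hn',
      div_le_iff₀' (by positivity)]
    exact h
  exact_mod_cast hratio

end AdaptiveInfo

theorem auxCost_le_natCast_mul (c : CostFunction) (d : ℕ+) {n : ℕ} (hn : 0 < n) {σ₀ σ : ℝ≥0}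
    (h : σ₀ ^ 2 ≤ n * σ ^ 2) : auxCost c σ d ≤ n * c σ₀ d :=
  sInf_le_of_le
    ⟨_, _, measurable_sampleMean, AdaptiveInfo.error_repeated_sampleMean_le hn h, rfl⟩
    (AdaptiveInfo.cost_repeated_le n σ₀ c d)

theorem auxCost_le_self (c : CostFunction) (σ : ℝ≥0) (d : ℕ+) : auxCost c σ d ≤ c σ d := by
  simpa only [Nat.cast_one, one_mul, le_refl, forall_const] using
    auxCost_le_natCast_mul c d one_pos (σ₀ := σ) (σ := σ)

theorem auxCost_le_ceil_mul (c : CostFunction) (d : ℕ+) {σ₀ σ : ℝ≥0} (hσ₀ : 0 < σ₀) (hσ : 0 < σ) :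
    auxCost c σ d ≤ (⌈σ₀ ^ 2 / σ ^ 2⌉₊ : ℝ≥0∞) * c σ₀ d :=
  auxCost_le_natCast_mul c d (Nat.ceil_pos.2 (by positivity))
    ((div_le_iff₀ (by positivity)).1 (Nat.le_ceil _))

section ConvexFunctions

theorem exists_affine_le_of_convexOn {s : Set ℝ} {g : ℝ → ℝ} (hg : ConvexOn ℝ s g) {m : ℝ}
    (hm : m ∈ interior s) : ∃ k, ∀ x ∈ s, g m + k * (x - m) ≤ g x := by
  refine ⟨derivWithin g (Ioi m) m, fun x hx => ?_⟩
  obtain hxm | rfl | hmx := lt_trichotomy x m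
  · have hslope := (hg.slope_le_leftDeriv_of_mem_interior hx hm hxm).trans
      (hg.leftDeriv_le_rightDeriv_of_mem_interior hm)
    rw [slope_def_field, div_le_iff₀ (sub_pos.2 hxm)] at hslope
    linarith
  · simp
  · have hslope := hg.rightDeriv_le_slope_of_mem_interior hm hx hmx
    rw [slope_def_field, le_div_iff₀ (sub_pos.2 hmx)] at hslope
    linarith

variable {φ : ℝ≥0 → ℝ≥0∞}

theorem convexOn_toReal_comp_toNNReal {b : ℝ≥0} (hφ : ConvexOn ℝ≥0 (Ioo 0 b) φ)
    (hfin : ∀ v ∈ Ioo 0 b, φ v ≠ ∞) :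
    ConvexOn ℝ (Ioo 0 (b : ℝ)) fun v => (φ v.toNNReal).toReal := by
  have hmem : ∀ {v : ℝ}, v ∈ Ioo 0 (b : ℝ) → v.toNNReal ∈ Ioo 0 b := fun hv =>
    ⟨Real.toNNReal_pos.2 hv.1, (Real.toNNReal_lt_iff_lt_coe hv.1.le).2 hv.2⟩
  refine ⟨convex_Ioo _ _, fun x hx y hy α β hα hβ hαβ => ?_⟩
  lift α to ℝ≥0 using hα
  lift β to ℝ≥0 using hβ
  have hconv := hφ.2 (hmem hx) (hmem hy) (zero_le (a := α)) (zero_le (a := β))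
    (by exact_mod_cast hαβ)
  have hcomb : (α • x + β • y).toNNReal = α • x.toNNReal + β • y.toNNReal := by
    simp only [NNReal.smul_def, smul_eq_mul]
    rw [Real.toNNReal_add (mul_nonneg α.coe_nonneg hx.1.le) (mul_nonneg β.coe_nonneg hy.1.le),
      Real.toNNReal_mul α.coe_nonneg, Real.toNNReal_mul β.coe_nonneg, Real.toNNReal_coe,
      Real.toNNReal_coe]
  have hαx : α • φ x.toNNReal ≠ ∞ := ENNReal.mul_ne_top ENNReal.coe_ne_top (hfin _ (hmem hx))
  have hβy : β • φ y.toNNReal ≠ ∞ := ENNReal.mul_ne_top ENNReal.coe_ne_top (hfin _ (hmem hy))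
  calc (φ (α • x + β • y).toNNReal).toReal
      ≤ (α • φ x.toNNReal + β • φ y.toNNReal).toReal := by
        rw [hcomb]
        exact ENNReal.toReal_mono (ENNReal.add_ne_top.2 ⟨hαx, hβy⟩) hconv
    _ = α • (φ x.toNNReal).toReal + β • (φ y.toNNReal).toReal := by
        rw [ENNReal.toReal_add hαx hβy, ENNReal.toReal_smul, ENNReal.toReal_smul]

theorem exists_add_mul_le_of_convexOn_of_antitoneOn {b m : ℝ≥0} (hφ : ConvexOn ℝ≥0 (Ioo 0 b) φ)
    (hanti : AntitoneOn φ (Ioo 0 b)) (hfin : ∀ v ∈ Ioo 0 b, φ v ≠ ∞) (hm : m ∈ Ioo 0 b) :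
    ∃ k : ℝ≥0, ∀ v ∈ Ioo 0 b, φ m + k * m ≤ φ v + k * v := by
  have hcoe : ∀ {v : ℝ≥0}, v ∈ Ioo 0 b → (v : ℝ) ∈ Ioo 0 (b : ℝ) := fun hv => by
    exact_mod_cast hv
  obtain ⟨k, hk⟩ := exists_affine_le_of_convexOn (convexOn_toReal_comp_toNNReal hφ hfin)
    (m := m) (by rw [interior_Ioo]; exact hcoe hm)
  have hline : ∀ v ∈ Ioo 0 b, (φ m).toReal + k * (v - m) ≤ (φ v).toReal := fun v hv => by
    simpa only [Real.toNNReal_coe] using hk v (hcoe hv)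
  have hk0 : k ≤ 0 := by
    obtain ⟨w, hmw, hwb⟩ := exists_between hm.2
    have hw : w ∈ Ioo 0 b := ⟨hm.1.trans hmw, hwb⟩
    have hdecr : (φ w).toReal ≤ (φ m).toReal :=
      ENNReal.toReal_mono (hfin m hm) (hanti hm hw hmw.le)
    exact nonpos_of_mul_nonpos_left (by linarith [hline w hw])
      (sub_pos.2 (NNReal.coe_lt_coe.2 hmw))
  refine ⟨(-k).toNNReal, fun v hv => ?_⟩
  have hfin_add : ∀ w ∈ Ioo 0 b, φ w + (-k).toNNReal * w ≠ ∞ := fun w hw =>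
    ENNReal.add_ne_top.2 ⟨hfin w hw, by finiteness⟩
  rw [← ENNReal.toReal_le_toReal (hfin_add m hm) (hfin_add v hv),
    ENNReal.toReal_add (hfin m hm) (by finiteness), ENNReal.toReal_add (hfin v hv) (by finiteness)]
  simp only [ENNReal.toReal_mul, ENNReal.coe_toReal, Real.coe_toNNReal _ (neg_nonneg.2 hk0)]
  linarith [hline v hv]

theorem div_mul_le_of_concaveOn (hφ : ConcaveOn ℝ≥0 (Ioi 0) φ) {x z : ℝ≥0} (hx : 0 < x)
    (hxz : x ≤ z) : ((x / z : ℝ≥0) : ℝ≥0∞) * φ z ≤ φ x := by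
  have hz : 0 < z := hx.trans_le hxz
  refine ENNReal.mul_le_of_forall_lt fun t ht b hb => ?_
  lift t to ℝ≥0 using ht.ne_top
  have htx : t * z < x := (lt_div_iff₀ hz).1 (ENNReal.coe_lt_coe.1 ht)
  have ht1 : t < 1 := (ENNReal.coe_lt_coe.1 ht).trans_le (div_le_one_of_le₀ hxz zero_le)
  have ht1' : 0 < 1 - t := tsub_pos_of_lt ht1
  have hw : 0 < (x - t * z) / (1 - t) := div_pos (tsub_pos_of_lt htx) ht1'
  have hconc := hφ.2 (mem_Ioi.2 hz) (mem_Ioi.2 hw) zero_le zero_le (add_tsub_cancel_of_le ht1.le)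
  rw [smul_eq_mul, smul_eq_mul, mul_div_cancel₀ _ ht1'.ne', add_tsub_cancel_of_le htx.le] at hconc
  calc (t : ℝ≥0∞) * b ≤ t • φ z := mul_le_mul_right hb.le _
    _ ≤ t • φ z + (1 - t) • φ ((x - t * z) / (1 - t)) := le_self_add
    _ ≤ φ x := hconc

theorem le_sum_of_concaveOn (hφ : ConcaveOn ℝ≥0 (Ioi 0) φ) {ι : Type*} {s : Finset ι}
    {x : ι → ℝ≥0} (hs : s.Nonempty) (hx : ∀ i ∈ s, 0 < x i) :
    φ (∑ i ∈ s, x i) ≤ ∑ i ∈ s, φ (x i) := by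
  set S := ∑ i ∈ s, x i
  have hS : 0 < S := Finset.sum_pos hx hs
  calc φ S = ((∑ i ∈ s, x i / S : ℝ≥0) : ℝ≥0∞) * φ S := by
        rw [← Finset.sum_div, div_self hS.ne', ENNReal.coe_one, one_mul]
    _ = ∑ i ∈ s, ((x i / S : ℝ≥0) : ℝ≥0∞) * φ S := by
        rw [ENNReal.ofNNReal_finsetSum, Finset.sum_mul]
    _ ≤ ∑ i ∈ s, φ (x i) := Finset.sum_le_sum fun i hi =>
        div_mul_le_of_concaveOn hφ (hx i hi) (Finset.single_le_sum (fun _ _ => zero_le) hi)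

theorem eq_top_of_concaveOn_of_monotoneOn (hφ : ConcaveOn ℝ≥0 (Ioi 0) φ)
    (hmono : MonotoneOn φ (Ioi 0)) {x z : ℝ≥0} (hz : 0 < z) (htop : φ z = ∞) (hx : 0 < x) :
    φ x = ∞ := by
  obtain hxz | hzx := le_total x z
  · have hle := div_mul_le_of_concaveOn hφ hx hxz
    rwa [htop, ENNReal.mul_top (ENNReal.coe_ne_zero.2 (div_pos hx hz).ne'), top_le_iff] at hle
  · exact top_le_iff.1 (htop.symm.trans_le (hmono hz hx hzx))

end ConvexFunctions

theorem two_mul_le_inv_add_sq_mul (x V : ℝ≥0∞) : 2 * x ≤ V⁻¹ + x ^ 2 * V := by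
  obtain rfl | hV := eq_or_ne V 0
  · simp
  obtain rfl | hx := eq_or_ne x 0
  · simp
  obtain rfl | hV' := eq_or_ne V ∞
  · simp [hx]
  obtain rfl | hx' := eq_or_ne x ∞
  · simp [hV]
  calc 2 * x = 2 * 1 * (x * V) * V⁻¹ := by
        rw [mul_one, mul_assoc, mul_assoc, ENNReal.mul_inv_cancel hV hV', mul_one]
    _ ≤ (1 ^ 2 + (x * V) ^ 2) * V⁻¹ := by
        lift x * V to ℝ≥0 using ENNReal.mul_ne_top hx' hV' with y
        exact mul_le_mul_left (mod_cast two_mul_le_add_sq 1 y) _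
    _ = V⁻¹ + x ^ 2 * V := by
        rw [one_pow, add_mul, one_mul, mul_pow, sq V, mul_assoc, mul_assoc,
          ENNReal.mul_inv_cancel hV hV', mul_one]

namespace CostFunction

variable (c : CostFunction) (d : ℕ+)

theorem h₁_inv_sq (σ : ℝ≥0) : c.h₁ d (σ ^ 2)⁻¹ = c σ d := by
  rw [h₁, one_div, inv_inv, NNReal.sqrt_sq]

theorem h₁_le_zero (x : ℝ≥0) : c.h₁ d x ≤ c 0 d := c.antitone_prec d zero_le

theorem monotoneOn_h₁ : MonotoneOn (c.h₁ d) (Ioi 0) := fun x (hx : 0 < x) _ _ hxz =>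
  c.antitone_prec d (NNReal.sqrt_le_sqrt.2 (by gcongr))

theorem h₂_eq_h₁ {lam v : ℝ≥0} (hv : v ∈ Ioo 0 lam) : c.h₂ lam d v = c.h₁ d (v⁻¹ - lam⁻¹) := by
  have hlam : 0 < lam := hv.1.trans hv.2
  have hsub : v⁻¹ - lam⁻¹ = (lam - v) / (lam * v) := by
    rw [tsub_div, div_mul_cancel_left₀ hlam.ne', mul_comm, div_mul_cancel_left₀ hv.1.ne']
  rw [h₂, h₁, hsub, one_div_div]

theorem antitoneOn_h₂ (lam : ℝ≥0) : AntitoneOn (c.h₂ lam d) (Ioo 0 lam) := fun v _ w hw hvw => by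
  have hpos : 0 < lam - w := tsub_pos_of_lt hw.2
  exact c.antitone_prec d (NNReal.sqrt_le_sqrt.2 (by gcongr))

variable {c d}

theorem mul_inv_sq_le {α : ℝ≥0} (hα : ∀ x : ℝ≥0, 0 < x → (α : ℝ≥0∞) * x ≤ c.h₁ d x) (σ : ℝ≥0) :
    (α : ℝ≥0∞) * ((σ : ℝ≥0∞) ^ 2)⁻¹ ≤ c σ d := by
  obtain rfl | hσ := eq_zero_or_pos σ
  · refine ENNReal.mul_le_of_forall_lt fun β hβ x hx => ?_
    lift x to ℝ≥0 using hx.ne_top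
    obtain rfl | hx0 := eq_zero_or_pos x
    · simp
    · exact (mul_le_mul_left hβ.le _).trans ((hα x hx0).trans (c.h₁_le_zero d x))
  · have hle := hα (σ ^ 2)⁻¹ (by positivity)
    rwa [h₁_inv_sq, ENNReal.coe_inv (by positivity), ENNReal.coe_pow] at hle

theorem eq_ofReal_div_sq_of_h₁_eq {α : ℝ} {σ₀ : ℝ≥0}
    (h : ENNReal.ofReal (α * ((σ₀ ^ 2)⁻¹ : ℝ≥0)) = c.h₁ d (σ₀ ^ 2)⁻¹) :
    c σ₀ d = ENNReal.ofReal (α / σ₀ ^ 2) := by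
  rw [← c.h₁_inv_sq, ← h, div_eq_mul_inv, NNReal.coe_inv, NNReal.coe_pow]

end CostFunction

namespace AdaptiveInfo

variable (N : AdaptiveInfo) {c : CostFunction} {d : ℕ+} {Φ : FinSeq → ℝ}

theorem mul_information_le_pathCost {α : ℝ≥0∞} (h : ∀ s : ℝ≥0, α * ((s : ℝ≥0∞) ^ 2)⁻¹ ≤ c s d)
    (y : FinSeq) : α * N.information y ≤ N.pathCost c d y := by
  rw [information, Finset.mul_sum]
  exact Finset.sum_le_sum fun i _ => h (N.precAt y i)

theorem mul_inv_sq_le_cost {α σ : ℝ≥0} (hα : ∀ s : ℝ≥0, α * ((s : ℝ≥0∞) ^ 2)⁻¹ ≤ c s d)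
    (hσ : 0 < σ) (hΦ : Measurable Φ) (he : N.error Φ ≤ σ) :
    α * ((σ : ℝ≥0∞) ^ 2)⁻¹ ≤ N.cost c d := by
  set x := ((σ : ℝ≥0∞) ^ 2)⁻¹ with hx
  have hσ2 : (σ : ℝ≥0∞) ^ 2 ≠ 0 := by positivity
  have hσ2' : (σ : ℝ≥0∞) ^ 2 ≠ ∞ := by finiteness
  have hx' : x ≠ ∞ := ENNReal.inv_ne_top.2 hσ2
  have hprior : ∀ lam : ℝ≥0, α * x ≤ N.cost c d + α * (lam : ℝ≥0∞)⁻¹ := fun lam => by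
    have hpath : ∀ y ∈ N.range, α * (2 * x) - α * (lam : ℝ≥0∞)⁻¹ ≤
        N.pathCost c d y + α * x ^ 2 * N.posteriorVar lam y := fun y _ => by
      rw [tsub_le_iff_right]
      calc α * (2 * x) ≤ α * ((N.posteriorVar lam y)⁻¹ + x ^ 2 * N.posteriorVar lam y) :=
            mul_le_mul_right (two_mul_le_inv_add_sq_mul x _) _
        _ = α * N.information y + α * x ^ 2 * N.posteriorVar lam y + α * (lam : ℝ≥0∞)⁻¹ := by
            nth_rw 1 [posteriorVar]
            rw [inv_inv]
            ring
        _ ≤ N.pathCost c d y + α * x ^ 2 * N.posteriorVar lam y + α * (lam : ℝ≥0∞)⁻¹ := by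
            gcongr
            exact N.mul_information_le_pathCost hα y
    have hcancel : α * x ^ 2 * (σ : ℝ≥0∞) ^ 2 = α * x := by
      rw [mul_assoc, sq x, mul_assoc, hx, ENNReal.inv_mul_cancel hσ2 hσ2', mul_one]
    have hdual := N.le_cost_add_mul_of_forall_le hΦ he hpath
    rw [hcancel, tsub_le_iff_right, two_mul, mul_add, add_right_comm] at hdual
    exact (ENNReal.add_le_add_iff_right (ENNReal.mul_ne_top ENNReal.coe_ne_top hx')).1 hdual
  have hlim : Tendsto (fun n : ℕ => N.cost c d + α * (n : ℝ≥0∞)⁻¹) atTop (nhds (N.cost c d)) := by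
    simpa using tendsto_const_nhds.add
      (ENNReal.Tendsto.const_mul ENNReal.tendsto_inv_nat_nhds_zero (.inr ENNReal.coe_ne_top))
  exact ge_of_tendsto' hlim fun n => hprior n

theorem ofReal_div_sq_le_cost {α : ℝ} (hα : ∀ x : ℝ≥0, 0 < x → ENNReal.ofReal (α * x) ≤ c.h₁ d x)
    {σ : ℝ≥0} (hσ : 0 < σ) (hΦ : Measurable Φ) (he : N.error Φ ≤ σ) :
    ENNReal.ofReal (α / σ ^ 2) ≤ N.cost c d := by
  have hsplit : ∀ t : ℝ≥0, ENNReal.ofReal (α * t) = α.toNNReal * (t : ℝ≥0∞) := fun t => by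
    rw [ENNReal.ofReal_mul' t.coe_nonneg, ENNReal.ofReal_coe_nnreal, ENNReal.ofReal]
  have hdiv : ENNReal.ofReal (α / σ ^ 2) = α.toNNReal * ((σ : ℝ≥0∞) ^ 2)⁻¹ := by
    rw [← ENNReal.coe_pow, ← ENNReal.coe_inv (by positivity), ← hsplit, div_eq_mul_inv]
    push_cast
    rfl
  rw [hdiv]
  exact N.mul_inv_sq_le_cost
    (CostFunction.mul_inv_sq_le fun x hx => (hsplit x).symm.trans_le (hα x hx)) hσ hΦ he

variable {y : FinSeq}

theorem cost_zero_le_pathCost (h : N.information y = ∞) : c 0 d ≤ N.pathCost c d y := by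
  obtain ⟨i, -, hi⟩ := ENNReal.sum_eq_top.1 h
  have hexact : N.precAt y i = 0 := by simpa using hi
  rw [← hexact]
  exact Finset.single_le_sum (f := fun i => c (N.precAt y i) d) (fun _ _ => zero_le)
    (Finset.mem_univ i)

theorem information_pos (hy : 0 < y.1) : 0 < N.information y :=
  (ENNReal.inv_pos.2 (by finiteness)).trans_le (Finset.single_le_sum
    (f := fun i => ((N.precAt y i : ℝ≥0∞) ^ 2)⁻¹) (fun _ _ => zero_le) (Finset.mem_univ ⟨0, hy⟩))

theorem h₁_le_pathCost (hc : ConcaveOn ℝ≥0 (Ioi 0) (c.h₁ d)) {x : ℝ≥0} (hx : 0 < x)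
    (hxy : x ≤ N.information y) : c.h₁ d x ≤ N.pathCost c d y := by
  by_cases hI : N.information y = ∞
  · exact (c.h₁_le_zero d x).trans (N.cost_zero_le_pathCost hI)
  have hnoisy : ∀ i, 0 < N.precAt y i := fun i => pos_iff_ne_zero.2 fun h =>
    ENNReal.sum_ne_top.1 hI i (Finset.mem_univ i) (by simp [h])
  have hsum : N.information y = ((∑ i, (N.precAt y i ^ 2)⁻¹ : ℝ≥0) : ℝ≥0∞) := by
    rw [ENNReal.ofNNReal_finsetSum]
    refine Finset.sum_congr rfl fun i _ => ?_
    rw [ENNReal.coe_inv (pow_pos (hnoisy i) 2).ne', ENNReal.coe_pow]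
  rw [hsum, ENNReal.coe_le_coe] at hxy
  have hne : (Finset.univ : Finset (Fin y.1)).Nonempty :=
    Finset.nonempty_of_sum_ne_zero (hx.trans_le hxy).ne'
  calc c.h₁ d x ≤ c.h₁ d (∑ i, (N.precAt y i ^ 2)⁻¹) :=
        c.monotoneOn_h₁ d hx (hx.trans_le hxy) hxy
    _ ≤ ∑ i, c.h₁ d (N.precAt y i ^ 2)⁻¹ :=
        le_sum_of_concaveOn hc hne fun i _ => inv_pos.2 (pow_pos (hnoisy i) 2)
    _ = N.pathCost c d y := Finset.sum_congr rfl fun i _ => c.h₁_inv_sq d _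

theorem h₂_le_pathCost (hc : ConcaveOn ℝ≥0 (Ioi 0) (c.h₁ d)) {lam v : ℝ≥0} (hv : v ∈ Ioo 0 lam)
    (hvy : N.posteriorVar lam y ≤ v) : c.h₂ lam d v ≤ N.pathCost c d y := by
  have hlam : 0 < lam := hv.1.trans hv.2
  rw [c.h₂_eq_h₁ d hv]
  refine N.h₁_le_pathCost hc (tsub_pos_of_lt (inv_strictAnti₀ hv.1 hv.2)) ?_
  rw [ENNReal.coe_sub, tsub_le_iff_left, ENNReal.coe_inv hv.1.ne', ENNReal.coe_inv hlam.ne']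
  exact ENNReal.inv_le_iff_inv_le.1 hvy

theorem posteriorVar_lt {lam : ℝ≥0} (hlam : 0 < lam) (hy : 0 < y.1) :
    N.posteriorVar lam y < lam := by
  rw [posteriorVar, ENNReal.inv_lt_iff_inv_lt]
  exact ENNReal.lt_add_right (ENNReal.inv_ne_top.2 (by positivity)) (N.information_pos hy).ne'

theorem cost_zero_le_cost (hΦ : Measurable Φ) (he : N.error Φ ≤ (0 : ℝ≥0)) :
    c 0 d ≤ N.cost c d := by
  have hpath : ∀ y ∈ N.range, c 0 d ≤ N.pathCost c d y + ∞ * N.posteriorVar 1 y := fun y _ => by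
    obtain hV | hV := eq_or_ne (N.posteriorVar 1 y) 0
    · refine (N.cost_zero_le_pathCost ?_).trans le_self_add
      simpa [posteriorVar] using hV
    · simp [ENNReal.top_mul hV]
  simpa using N.le_cost_add_mul_of_forall_le hΦ he hpath

theorem cost_eq_top (hc : ConcaveOn ℝ≥0 (Ioi 0) (c.h₁ d)) {z : ℝ≥0} (hz : 0 < z)
    (htop : c.h₁ d z = ∞) (hΦ : Measurable Φ) {σ : ℝ≥0} (he : N.error Φ ≤ σ) :
    N.cost c d = ∞ := by
  have hpath : ∀ y ∈ N.range, ∞ ≤ N.pathCost c d y + 0 * N.posteriorVar 1 y := fun y hy => by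
    obtain ⟨x, hx, hxy⟩ := ENNReal.lt_iff_exists_nnreal_btwn.1
      (N.information_pos (N.length_pos_of_error_le hΦ he hy))
    have hx' : 0 < x := ENNReal.coe_pos.1 hx
    rw [zero_mul, add_zero, ← eq_top_of_concaveOn_of_monotoneOn hc (c.monotoneOn_h₁ d) hz htop hx']
    exact N.h₁_le_pathCost hc hx' hxy.le
  simpa using N.le_cost_add_mul_of_forall_le hΦ he hpath

theorem h₂_le_cost (hc : ConcaveOn ℝ≥0 (Ioi 0) (c.h₁ d)) (hfin : ∀ x, 0 < x → c.h₁ d x ≠ ∞)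
    {lam σ : ℝ≥0} (hσ : σ ^ 2 ∈ Ioo 0 lam) (hconv : ConvexOn ℝ≥0 (Ioo 0 lam) (c.h₂ lam d))
    (hΦ : Measurable Φ) (he : N.error Φ ≤ σ) : c.h₂ lam d (σ ^ 2) ≤ N.cost c d := by
  have hfin₂ : ∀ v ∈ Ioo 0 lam, c.h₂ lam d v ≠ ∞ := fun v hv => by
    rw [c.h₂_eq_h₁ d hv]
    exact hfin _ (tsub_pos_of_lt (inv_strictAnti₀ hv.1 hv.2))
  obtain ⟨k, hk⟩ :=
    exists_add_mul_le_of_convexOn_of_antitoneOn hconv (c.antitoneOn_h₂ d lam) hfin₂ hσ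
  have hpath : ∀ y ∈ N.range, c.h₂ lam d (σ ^ 2) + k * (σ : ℝ≥0∞) ^ 2 ≤
      N.pathCost c d y + k * N.posteriorVar lam y := fun y hy => by
    have hlt := N.posteriorVar_lt (hσ.1.trans hσ.2) (N.length_pos_of_error_le hΦ he hy)
    rw [← coe_toNNReal_posteriorVar] at hlt ⊢
    set V := (N.posteriorVar lam y).toNNReal
    have hlim : Tendsto (fun v : ℝ≥0 => N.pathCost c d y + k * (v : ℝ≥0∞))
        (nhdsWithin V (Ioi V)) (nhds (N.pathCost c d y + k * V)) :=
      ((continuous_const.add ((ENNReal.continuous_const_mul ENNReal.coe_ne_top).comp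
        ENNReal.continuous_coe)).tendsto V).mono_left nhdsWithin_le_nhds
    refine ge_of_tendsto hlim ?_
    filter_upwards [Ioo_mem_nhdsGT (ENNReal.coe_lt_coe.1 hlt)] with v hv
    have hv' : v ∈ Ioo 0 lam := ⟨zero_le.trans_lt hv.1, hv.2⟩
    rw [← ENNReal.coe_pow]
    refine (hk v hv').trans (add_le_add_left (N.h₂_le_pathCost hc hv' ?_) _)
    rw [← coe_toNNReal_posteriorVar]
    exact ENNReal.coe_le_coe.2 hv.1.le
  exact (ENNReal.add_le_add_iff_right (by finiteness)).1
    (N.le_cost_add_mul_of_forall_le hΦ he hpath)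

theorem le_cost_of_concaveOn_of_convexOn (hc : ConcaveOn ℝ≥0 (Ioi 0) (c.h₁ d))
    (hconv : ∀ᶠ lam : ℝ≥0 in atTop, ConvexOn ℝ≥0 (Ioo 0 lam) (c.h₂ lam d))
    (hΦ : Measurable Φ) {σ : ℝ≥0} (he : N.error Φ ≤ σ) : c σ d ≤ N.cost c d := by
  obtain rfl | hσ := eq_zero_or_pos σ
  · exact N.cost_zero_le_cost hΦ he
  by_cases! hfin : ∃ z, 0 < z ∧ c.h₁ d z = ∞
  · obtain ⟨z, hz, htop⟩ := hfin
    exact le_top.trans_eq (N.cost_eq_top hc hz htop hΦ he).symm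
  set x := (σ ^ 2)⁻¹
  have hx : 0 < x := by positivity
  have hbound : ∀ᶠ lam : ℝ≥0 in atTop,
      (((x - lam⁻¹) / x : ℝ≥0) : ℝ≥0∞) * c σ d ≤ N.cost c d := by
    filter_upwards [hconv, eventually_gt_atTop (σ ^ 2)] with lam hlam hσlam
    have hmem : σ ^ 2 ∈ Ioo 0 lam := ⟨by positivity, hσlam⟩
    calc (((x - lam⁻¹) / x : ℝ≥0) : ℝ≥0∞) * c σ d
        = (((x - lam⁻¹) / x : ℝ≥0) : ℝ≥0∞) * c.h₁ d x := by rw [c.h₁_inv_sq]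
      _ ≤ c.h₁ d (x - lam⁻¹) := div_mul_le_of_concaveOn hc
          (tsub_pos_of_lt (inv_strictAnti₀ hmem.1 hmem.2)) tsub_le_self
      _ = c.h₂ lam d (σ ^ 2) := (c.h₂_eq_h₁ d hmem).symm
      _ ≤ N.cost c d := N.h₂_le_cost hc hfin hmem hlam hΦ he
  have hratio : Tendsto (fun lam : ℝ≥0 => (x - lam⁻¹) / x) atTop (nhds 1) := by
    have hinv : Tendsto (fun lam : ℝ≥0 => lam⁻¹) atTop (nhds 0) := tendsto_inv_atTop_zero
    simpa [hx.ne'] using ((tendsto_const_nhds (x := x)).sub hinv).div_const x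
  have hlim := ENNReal.Tendsto.mul_const (b := c σ d) (ENNReal.tendsto_coe.2 hratio)
    (.inl (by simp))
  rw [ENNReal.coe_one, one_mul] at hlim
  exact le_of_tendsto hlim hbound

end AdaptiveInfo

theorem lemma4p2 (c : CostFunction) (d : ℕ+) :
    (ConcaveOn ℝ≥0 (Set.Ioi 0) (c.h₁ d) →
      (∀ᶠ lam : ℝ≥0 in Filter.atTop, ConvexOn ℝ≥0 (Set.Ioo 0 lam) (c.h₂ lam d)) →
      ∀ σ : ℝ≥0, auxCost c σ d = c σ d) ∧
    (∀ (α : ℝ) (x₀ : ℝ≥0), 0 < x₀ →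
      ENNReal.ofReal (α * x₀) = c.h₁ d x₀ →
      (∀ x : ℝ≥0, 0 < x → ENNReal.ofReal (α * x) ≤ c.h₁ d x) →
      ∀ σ₀ : ℝ≥0, σ₀ ^ 2 = 1 / x₀ → ∀ σ : ℝ≥0, 0 < σ →
        ENNReal.ofReal (α / σ ^ 2) ≤ auxCost c σ d ∧
        auxCost c σ d ≤ (⌈σ₀ ^ 2 / σ ^ 2⌉₊ : ℝ≥0∞) * ENNReal.ofReal (α / σ₀ ^ 2)) ∧
    (∀ σ₀ : ℝ≥0, 0 < σ₀ → ∀ σ : ℝ≥0, 0 < σ →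
      auxCost c σ d ≤ (⌈σ₀ ^ 2 / σ ^ 2⌉₊ : ℝ≥0∞) * c σ₀ d) := by
  refine ⟨fun hc hconv σ => le_antisymm (auxCost_le_self c σ d) (le_sInf ?_),
    fun α x₀ hx₀ hα₀ hα σ₀ hσ₀ σ hσ => ⟨le_sInf ?_, ?_⟩,
    fun σ₀ hσ₀ σ hσ => auxCost_le_ceil_mul c d hσ₀ hσ⟩
  · rintro _ ⟨N, Φ, hΦ, he, rfl⟩
    exact N.le_cost_of_concaveOn_of_convexOn hc hconv hΦ he
  · rintro _ ⟨N, Φ, hΦ, he, rfl⟩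
    exact N.ofReal_div_sq_le_cost hα hσ hΦ he
  · obtain rfl : x₀ = (σ₀ ^ 2)⁻¹ := by rw [hσ₀, one_div, inv_inv]
    have hpos : 0 < σ₀ := pos_iff_ne_zero.2 fun h => by simp [h] at hx₀
    rw [← CostFunction.eq_ofReal_div_sq_of_h₁_eq hα₀]
    exact auxCost_le_ceil_mul c d hpos hσ
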